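/- Let $G$ be an Abelian group. A subgroup $K$ of $G$ is called strictly invariant if $f(K)\subseteq K$ for every injective homomorphism $f:K\to G$, and strongly invariant if $f(K)\subseteq K$ for every homomorphism $f:K\to G$. An Abelian group is called cocyclic if it has a nonzero element that lies in every nonzero subgroup (equivalently, if it is isomorphic to $\mathbb{Z}(p^k)$ for some prime $p$ and some $1\le k\le\infty$; such a group is a $p$-group for exactly one prime $p$). Then the following are equivalent: (1) every subgroup of $G$ is strictly invariant; (2) $G$ is a (possibly empty or infinite) direct sum of cocyclic groups such that, for each prime $p$, at most one of the summands is a $p$-group; (3) every subgroup of $G$ is strongly invariant. -/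

import Mathlib

/-- A subgroup `K` of an Abelian group `G` is strongly invariant if `f(K) ≤ K` for every
homomorphism `f : K → G`. -/
def IsStronglyInvariant {G : Type*} [AddCommGroup G] (K : AddSubgroup G) : Prop :=
  ∀ f : K →+ G, f.range ≤ K

/-- A subgroup `K` of an Abelian group `G` is strictly invariant if `f(K) ≤ K` for every
monomorphism (injective homomorphism) `f : K → G`. -/
def IsStrictlyInvariant {G : Type*} [AddCommGroup G] (K : AddSubgroup G) : Prop :=
  ∀ f : K →+ G, Function.Injective f → f.range ≤ K

/-- An Abelian group is cocyclic if it has a nonzero element lying in every nonzero subgroup,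
i.e. the intersection of all its nonzero subgroups is nonzero and the group itself is nonzero.
(Up to isomorphism, these are the groups `ℤ(p^k)` with `p` prime and `1 ≤ k ≤ ∞`.) -/
def IsCocyclic (C : Type*) [AddCommGroup C] : Prop :=
  ∃ c : C, c ≠ 0 ∧ ∀ H : AddSubgroup C, H ≠ ⊥ → c ∈ H

/-- `C` is a `p`-group: every element is annihilated by a power of `p`. -/
def IsPrimaryGroup (p : ℕ) (C : Type*) [AddCommGroup C] : Prop :=
  ∀ x : C, ∃ n : ℕ, p ^ n • x = 0

/-- `G` is the direct sum of a family (possibly empty) of cocyclic subgroups, with at most one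
summand for each prime, that is, for each prime `p` at most one summand is a `p`-group.
(Every cocyclic group is a `p`-group for exactly one prime `p`. So the index set
injects into the set of primes, and an index type in `Type` is no restriction.) -/
def IsDirectSumOfCocyclicsAtMostOnePerPrime (G : Type*) [AddCommGroup G] : Prop :=
  ∃ (ι : Type) (_ : DecidableEq ι) (A : ι → AddSubgroup G),
    DirectSum.IsInternal A ∧
    (∀ i, IsCocyclic (A i)) ∧
    ∀ p : ℕ, p.Prime → ∀ i j : ι,
      IsPrimaryGroup p (A i) → IsPrimaryGroup p (A j) → i = j

/-! All conditions amount to `IsTorsionWithCyclicSocles`. If all subgroups are strictly invariant,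
elements with equal annihilators generate each other: applied to `x` and `2x` this rules out
infinite order, and applied to two elements of order `p` it makes the socle cyclic. Conversely,
torsion and cyclic socles put `y` in `⟨x⟩` whenever the order of `y` divides that of `x`;
homomorphisms do not enlarge orders in this sense, so every subgroup is strongly invariant. The
direct sum is the primary decomposition. -/

/-- `G` is torsion and, for every prime `p`, its `p`-socle `{x | p • x = 0}` is cyclic: any
nonzero element of it generates it. -/
def IsTorsionWithCyclicSocles (G : Type*) [AddCommGroup G] : Prop :=
  (∀ x : G, IsOfFinAddOrder x) ∧
    ∀ p : ℕ, p.Prime → ∀ u v : G, u ≠ 0 → p • u = 0 → p • v = 0 → v ∈ AddSubgroup.zmultiples u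

/-! ### Invariance and orders of elements -/

section ElementOrders

variable {G : Type*} [AddCommGroup G]

/-- Elements with the same annihilator in `ℤ` are matched by a monomorphism defined on the
cyclic subgroup generated by the first one. -/
theorem exists_injective_hom_zmultiples {x y : G} (h : ∀ n : ℤ, n • x = 0 ↔ n • y = 0) :
    ∃ f : AddSubgroup.zmultiples x →+ G, Function.Injective f ∧
      f ⟨x, AddSubgroup.mem_zmultiples x⟩ = y := by
  have hc : ∀ k : AddSubgroup.zmultiples x, ∃ n : ℤ, n • x = k :=
    fun k ↦ AddSubgroup.mem_zmultiples_iff.mp k.2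
  choose c hc using hc
  -- One direction makes the map independent of the chosen coefficients; the other makes it
  -- injective.
  have key : ∀ m n : ℤ, m • x = n • x ↔ m • y = n • y := fun m n ↦ by
    rw [← sub_eq_zero, ← sub_smul, h, sub_smul, sub_eq_zero]
  refine ⟨AddMonoidHom.mk' (fun k ↦ c k • y) fun a b ↦ ?_, fun a b hab ↦ ?_, ?_⟩
  · rw [← add_smul, ← key, add_smul, hc, hc, hc, AddSubgroup.coe_add]
  · have hab' : c a • y = c b • y := hab
    rw [← key, hc, hc] at hab'
    exact Subtype.ext hab'
  · change c _ • y = y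
    have := (key (c ⟨x, AddSubgroup.mem_zmultiples x⟩) 1).mp (by rw [hc, one_smul])
    rwa [one_smul] at this

theorem mem_zmultiples_of_isStrictlyInvariant
    (hG : ∀ K : AddSubgroup G, IsStrictlyInvariant K) {x y : G}
    (h : ∀ n : ℤ, n • x = 0 ↔ n • y = 0) : y ∈ AddSubgroup.zmultiples x := by
  obtain ⟨f, hf, rfl⟩ := exists_injective_hom_zmultiples h
  exact hG _ f hf ⟨_, rfl⟩

theorem zsmul_eq_zero_iff_of_prime {p : ℕ} (hp : p.Prime) {u : G} (hu : u ≠ 0)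
    (hpu : p • u = 0) (n : ℤ) : n • u = 0 ↔ (p : ℤ) ∣ n := by
  have : Fact p.Prime := ⟨hp⟩
  rw [← addOrderOf_eq_prime hpu hu, addOrderOf_dvd_iff_zsmul_eq_zero]

theorem IsTorsionWithCyclicSocles.of_isStrictlyInvariant
    (hG : ∀ K : AddSubgroup G, IsStrictlyInvariant K) : IsTorsionWithCyclicSocles G := by
  refine ⟨fun x ↦ ?_, fun p hp u v hu hpu hpv ↦ ?_⟩
  · by_contra hx
    have hx' : ∀ n : ℤ, n • x = 0 → n = 0 := fun n hn ↦ by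
      by_contra h0
      exact hx (isOfFinAddOrder_iff_zsmul_eq_zero.mpr ⟨n, h0, hn⟩)
    have hmem : x ∈ AddSubgroup.zmultiples ((2 : ℤ) • x) := by
      refine mem_zmultiples_of_isStrictlyInvariant hG fun n ↦ ⟨fun hn ↦ ?_, fun hn ↦ ?_⟩
      · rw [smul_smul] at hn
        have := hx' _ hn
        rw [show n = 0 by omega, zero_smul]
      · rw [smul_comm, hn, smul_zero]
    obtain ⟨k, hk⟩ := AddSubgroup.mem_zmultiples_iff.mp hmem
    have := hx' (k * 2 - 1) (by rw [sub_smul, one_smul, mul_smul, hk, sub_self])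
    omega
  · by_cases hv : v = 0
    · exact hv ▸ zero_mem _
    · exact mem_zmultiples_of_isStrictlyInvariant hG fun n ↦ by
        rw [zsmul_eq_zero_iff_of_prime hp hu hpu, zsmul_eq_zero_iff_of_prime hp hv hpv]

/-- A nonzero element killed by `n ≠ 0` has a multiple of prime order `p ∣ n`. -/
theorem exists_prime_zmultiples {x : G} (hx : x ≠ 0) {n : ℕ} (hn : n ≠ 0) (hnx : n • x = 0) :
    ∃ p : ℕ, p.Prime ∧ p ∣ n ∧ ∃ u ∈ AddSubgroup.zmultiples x, u ≠ 0 ∧ p • u = 0 := by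
  have hd : addOrderOf x ∣ n := addOrderOf_dvd_of_nsmul_eq_zero hnx
  obtain ⟨p, hp, k, hk⟩ := Nat.exists_prime_and_dvd (mt AddMonoid.addOrderOf_eq_one_iff.mp hx)
  have hpos : 0 < addOrderOf x := Nat.pos_of_dvd_of_pos hd (Nat.pos_of_ne_zero hn)
  refine ⟨p, hp, (Dvd.intro _ hk.symm).trans hd, k • x,
    nsmul_mem (AddSubgroup.mem_zmultiples x) k, fun h0 ↦ ?_, ?_⟩
  · have hk0 : 0 < k := Nat.pos_of_ne_zero fun h ↦ by simp [hk, h] at hpos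
    have := Nat.le_of_dvd hk0 (addOrderOf_dvd_of_nsmul_eq_zero h0)
    have := hp.two_le
    nlinarith
  · rw [smul_smul, ← hk, addOrderOf_nsmul_eq_zero]

/-- Induction on the order of `y`: for a prime `p` dividing it, `p • y = m • (p • x)`, so `y - m •
x` lies in the `p`-socle, which a multiple of `x` generates. -/
theorem IsTorsionWithCyclicSocles.mem_zmultiples (hG : IsTorsionWithCyclicSocles G) (n : ℕ) :
    ∀ x y : G, addOrderOf y = n → n ∣ addOrderOf x → y ∈ AddSubgroup.zmultiples x := by
  induction n using Nat.strong_induction_on with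
  | _ n ih =>
  intro x y hy hyx
  by_cases hy0 : y = 0
  · exact hy0 ▸ zero_mem _
  obtain ⟨p, hp, k, hk⟩ :=
    Nat.exists_prime_and_dvd (mt AddMonoid.addOrderOf_eq_one_iff.mp hy0)
  obtain ⟨l, hl⟩ := hyx
  have hxpos : 0 < addOrderOf x := (hG.1 x).addOrderOf_pos
  have hypos : 0 < addOrderOf y := (hG.1 y).addOrderOf_pos
  have hk0 : 0 < k := Nat.pos_of_ne_zero fun h ↦ by simp [hk, h] at hypos
  have hx : addOrderOf x = p * (k * l) := by rw [hl, ← hy, hk, mul_assoc]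
  have hkl : 0 < k * l := Nat.pos_of_ne_zero fun h ↦ by simp [hx, h] at hxpos
  have hpy : addOrderOf (p • y) = k := by
    rw [addOrderOf_nsmul_of_dvd hp.ne_zero (Dvd.intro _ hk.symm), hk,
      Nat.mul_div_cancel_left _ hp.pos]
  have hpx : addOrderOf (p • x) = k * l := by
    rw [addOrderOf_nsmul_of_dvd hp.ne_zero (Dvd.intro _ hx.symm), hx,
      Nat.mul_div_cancel_left _ hp.pos]
  have hlt : k < n := by
    have := hp.two_le
    nlinarith
  obtain ⟨m, hm⟩ := AddSubgroup.mem_zmultiples_iff.mp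
    (ih k hlt (p • x) (p • y) hpy (hpx ▸ Dvd.intro _ rfl))
  have hdiff : y - m • x ∈ AddSubgroup.zmultiples ((k * l) • x) := by
    refine hG.2 p hp _ _ (fun h0 ↦ ?_) ?_ ?_
    · have := Nat.le_of_dvd hkl (addOrderOf_dvd_of_nsmul_eq_zero h0)
      have := hp.two_le
      nlinarith
    · rw [smul_smul, ← hx, addOrderOf_nsmul_eq_zero]
    · rw [smul_sub, smul_comm p m x, hm, sub_self]
  have hle : AddSubgroup.zmultiples ((k * l) • x) ≤ AddSubgroup.zmultiples x :=
    AddSubgroup.zmultiples_le_of_mem (nsmul_mem (AddSubgroup.mem_zmultiples x) _)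
  simpa using add_mem (hle hdiff) (zsmul_mem (AddSubgroup.mem_zmultiples x) m)

theorem IsTorsionWithCyclicSocles.isStronglyInvariant (hG : IsTorsionWithCyclicSocles G)
    (K : AddSubgroup G) : IsStronglyInvariant K := by
  rintro f _ ⟨x, rfl⟩
  have hd : addOrderOf (f x) ∣ addOrderOf (x : G) := by
    rw [AddSubgroup.addOrderOf_coe]
    exact addOrderOf_map_dvd f x
  exact AddSubgroup.zmultiples_le_of_mem x.2 (hG.mem_zmultiples _ _ _ rfl hd)

end ElementOrders

/-! ### Cocyclic groups -/

section Cocyclic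

variable {C : Type*} [AddCommGroup C]

theorem mem_zmultiples_of_forall_subgroup {c : C} (hc : ∀ H : AddSubgroup C, H ≠ ⊥ → c ∈ H)
    {x : C} (hx : x ≠ 0) : c ∈ AddSubgroup.zmultiples x :=
  hc _ (mt AddSubgroup.zmultiples_eq_bot.mp hx)

theorem IsCocyclic.isOfFinAddOrder (hC : IsCocyclic C) (x : C) : IsOfFinAddOrder x := by
  obtain ⟨c, hc0, hc⟩ := hC
  by_cases hx : x = 0
  · exact hx ▸ IsOfFinAddOrder.zero
  by_cases hcx : ∃ k : ℤ, k ≠ 0 ∧ k • x = 0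
  · exact isOfFinAddOrder_iff_zsmul_eq_zero.mpr hcx
  push Not at hcx
  obtain ⟨k, hk⟩ := AddSubgroup.mem_zmultiples_iff.mp (mem_zmultiples_of_forall_subgroup hc hx)
  have hk0 : k ≠ 0 := by
    rintro rfl
    exact hc0 (by rw [← hk, zero_smul])
  -- With `x` of infinite order, `c = k • x` cannot be a multiple of `(2 * k) • x`.
  obtain ⟨m, hm⟩ := AddSubgroup.mem_zmultiples_iff.mp
    (mem_zmultiples_of_forall_subgroup hc (hcx (2 * k) (by omega)))
  exfalso
  refine hcx (m * (2 * k) - k) (fun h ↦ ?_) (by rw [sub_smul, mul_smul, hm, hk, sub_self])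
  have h' : (2 * m - 1) * k = 0 := by linarith
  rcases mul_eq_zero.mp h' with h | h
  · omega
  · exact hk0 h

theorem IsCocyclic.mem_zmultiples (hC : IsCocyclic C) {p : ℕ} (hp : p.Prime) {u v : C}
    (hu : u ≠ 0) (hpv : p • v = 0) : v ∈ AddSubgroup.zmultiples u := by
  obtain ⟨c, hc0, hc⟩ := hC
  by_cases hv : v = 0
  · exact hv ▸ zero_mem _
  obtain ⟨k, hk⟩ := AddSubgroup.mem_zmultiples_iff.mp (mem_zmultiples_of_forall_subgroup hc hv)
  have hcop : IsCoprime (p : ℤ) k := by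
    rw [(Nat.prime_iff_prime_int.mp hp).irreducible.coprime_iff_not_dvd,
      ← zsmul_eq_zero_iff_of_prime hp hv hpv, hk]
    exact hc0
  obtain ⟨a, b, hab⟩ := hcop
  have hvc : v = b • c := by
    calc v = (a * p + b * k) • v := by rw [hab, one_smul]
      _ = b • c := by rw [add_smul, mul_smul, mul_smul, hk, natCast_zsmul, hpv, smul_zero,
        zero_add]
  rw [hvc]
  exact zsmul_mem (mem_zmultiples_of_forall_subgroup hc hu) b

/-- Whatever kills a nonzero element kills `c`, so torsion at a second prime would force `c = 0`. -/
theorem IsCocyclic.isPrimaryGroup (hC : IsCocyclic C) {p : ℕ} (hp : p.Prime) {u : C}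
    (hu : u ≠ 0) (hpu : p • u = 0) : IsPrimaryGroup p C := by
  intro x
  have hfin := hC.isOfFinAddOrder x
  obtain ⟨n, m, hpm, hnm⟩ :=
    Nat.exists_eq_pow_mul_and_not_dvd hfin.addOrderOf_pos.ne' p hp.ne_one
  refine ⟨n, ?_⟩
  by_contra hx
  have hm0 : m ≠ 0 := by
    rintro rfl
    exact hpm (dvd_zero p)
  obtain ⟨q, hq, hqm, w, -, hw, hqw⟩ := exists_prime_zmultiples hx hm0
    (by rw [smul_smul, mul_comm, ← hnm, addOrderOf_nsmul_eq_zero])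
  obtain ⟨c, hc0, hc⟩ := hC
  have hkill : ∀ {r : ℕ} {z : C}, z ≠ 0 → r • z = 0 → r • c = 0 := by
    intro r z hz hrz
    obtain ⟨k, rfl⟩ := AddSubgroup.mem_zmultiples_iff.mp
      (mem_zmultiples_of_forall_subgroup hc hz)
    rw [smul_comm, hrz, smul_zero]
  have hdvd := (zsmul_eq_zero_iff_of_prime hp hc0 (hkill hu hpu) q).mp
    (by rw [natCast_zsmul, hkill hw hqw])
  exact hpm ((Int.natCast_dvd_natCast.mp hdvd).trans hqm)

end Cocyclic

/-! ### Primary decomposition -/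

section Decomposition

variable {G : Type*} [AddCommGroup G]

theorem IsDirectSumOfCocyclicsAtMostOnePerPrime.isTorsionWithCyclicSocles
    (hG : IsDirectSumOfCocyclicsAtMostOnePerPrime G) : IsTorsionWithCyclicSocles G := by
  obtain ⟨ι, _, A, hA, hcoc, huniq⟩ := hG
  refine ⟨fun x ↦ ?_, fun p hp u v hu hpu hpv ↦ ?_⟩
  · obtain ⟨y, rfl⟩ := hA.surjective x
    induction y using DirectSum.induction_on with
    | zero => simp
    | of i a =>
      rw [DirectSum.coeAddMonoidHom_of]
      exact (A i).subtype.isOfFinAddOrder ((hcoc i).isOfFinAddOrder a)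
    | add a b ha hb =>
      rw [map_add]
      exact ha.add hb
  · obtain ⟨a, rfl⟩ := hA.surjective u
    obtain ⟨b, rfl⟩ := hA.surjective v
    have hcomp : ∀ {d : DirectSum ι fun i ↦ A i},
        p • DirectSum.coeAddMonoidHom A d = 0 → ∀ i, p • d i = 0 := by
      intro d hd i
      have : p • d = 0 := hA.injective (by rw [map_nsmul, hd, map_zero])
      rw [← DFinsupp.nsmul_apply]
      exact congrArg (fun e : DirectSum ι fun i ↦ A i ↦ e i) this
    have ha0 : a ≠ 0 := by
      rintro rfl
      exact hu (map_zero _)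
    obtain ⟨i, hi⟩ : ∃ i, a i ≠ 0 := by
      by_contra! h
      exact ha0 (DFinsupp.ext h)
    -- A summand with nonzero `p`-torsion is a `p`-group, so the whole `p`-socle sits in summand
    -- `i`.
    have hsupp : ∀ {d : DirectSum ι fun i ↦ A i}, p • DirectSum.coeAddMonoidHom A d = 0 →
        d = DirectSum.of (fun i ↦ A i) i (d i) := by
      intro d hd
      refine DFinsupp.ext fun j ↦ ?_
      by_cases hj : j = i
      · subst hj
        exact (DirectSum.of_eq_same (β := fun i ↦ A i) j (d j)).symm
      · refine Eq.trans ?_ (DirectSum.of_eq_of_ne (β := fun i ↦ A i) i j (d i) hj).symm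
        by_contra hdj
        exact hj (huniq p hp j i ((hcoc j).isPrimaryGroup hp hdj (hcomp hd j))
          ((hcoc i).isPrimaryGroup hp hi (hcomp hpu i)))
    obtain ⟨k, hk⟩ := AddSubgroup.mem_zmultiples_iff.mp
      ((hcoc i).mem_zmultiples hp hi (hcomp hpv i))
    refine AddSubgroup.mem_zmultiples_iff.mpr ⟨k, ?_⟩
    rw [← map_zsmul, hsupp hpu, hsupp hpv, ← hk, ← map_zsmul]

/-- The subgroup of the elements killed by a power of `p`. -/
def primarySubgroup (G : Type*) [AddCommGroup G] (p : ℕ) : AddSubgroup G where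
  carrier := {x | ∃ n : ℕ, p ^ n • x = 0}
  zero_mem' := ⟨0, smul_zero _⟩
  add_mem' := by
    rintro x y ⟨m, hm⟩ ⟨n, hn⟩
    refine ⟨m + n, ?_⟩
    rw [smul_add, pow_add, mul_smul, mul_smul, hn, smul_zero, smul_comm, hm, smul_zero, add_zero]
  neg_mem' := by
    rintro x ⟨m, hm⟩
    exact ⟨m, by rw [smul_neg, hm, neg_zero]⟩

/-- The subgroup of the elements killed by an integer coprime to `p`. -/
def coprimeTorsionSubgroup (G : Type*) [AddCommGroup G] (p : ℕ) : AddSubgroup G where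
  carrier := {x | ∃ n : ℕ, n.Coprime p ∧ n • x = 0}
  zero_mem' := ⟨1, Nat.coprime_one_left p, smul_zero _⟩
  add_mem' := by
    rintro x y ⟨m, hmp, hm⟩ ⟨n, hnp, hn⟩
    refine ⟨m * n, hmp.mul_left hnp, ?_⟩
    rw [smul_add, mul_smul, mul_smul, hn, smul_zero, smul_comm, hm, smul_zero, add_zero]
  neg_mem' := by
    rintro x ⟨m, hmp, hm⟩
    exact ⟨m, hmp, by rw [smul_neg, hm, neg_zero]⟩

theorem eq_zero_of_coprime_nsmul {m n : ℕ} (h : m.Coprime n) {x : G} (hm : m • x = 0)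
    (hn : n • x = 0) : x = 0 := by
  have := Nat.dvd_gcd (addOrderOf_dvd_of_nsmul_eq_zero hm) (addOrderOf_dvd_of_nsmul_eq_zero hn)
  rw [h.gcd_eq_one, Nat.dvd_one] at this
  exact AddMonoid.addOrderOf_eq_one_iff.mp this

/-- The other primary components all lie in `coprimeTorsionSubgroup G p`, which meets the
`p`-component trivially. -/
theorem iSupIndep_primarySubgroup {P : Set ℕ} (hP : ∀ p ∈ P, p.Prime) :
    iSupIndep fun p : P ↦ primarySubgroup G p := by
  intro p
  rw [AddSubgroup.disjoint_def]
  rintro x ⟨n, hn⟩ hx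
  have hle : (⨆ q : P, ⨆ _ : q ≠ p, primarySubgroup G q) ≤ coprimeTorsionSubgroup G p := by
    refine iSup₂_le fun q hq y ↦ ?_
    rintro ⟨m, hm⟩
    exact ⟨(q : ℕ) ^ m, Nat.Coprime.pow_left m
      ((Nat.coprime_primes (hP q q.2) (hP p p.2)).mpr fun h ↦ hq (Subtype.ext h)), hm⟩
  obtain ⟨m, hmp, hm⟩ := hle hx
  exact eq_zero_of_coprime_nsmul (hmp.pow_right n) hm hn

theorem mem_iSup_primarySubgroup {P : Set ℕ}
    (hP : ∀ p : ℕ, p.Prime → ∀ x : G, x ≠ 0 → p • x = 0 → p ∈ P) (n : ℕ) :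
    ∀ x : G, n ≠ 0 → n • x = 0 → x ∈ ⨆ p : P, primarySubgroup G p := by
  induction n using Nat.recOnPosPrimePosCoprime with
  | zero => exact fun x h ↦ absurd rfl h
  | one =>
    intro x _ hx
    rw [one_smul] at hx
    exact hx ▸ zero_mem _
  | prime_pow p n hp _ =>
    intro x _ hx
    by_cases hx0 : x = 0
    · exact hx0 ▸ zero_mem _
    obtain ⟨q, hq, hqp, u, -, hu, hqu⟩ := exists_prime_zmultiples hx0 (pow_ne_zero n hp.ne_zero) hx
    obtain rfl := (Nat.prime_dvd_prime_iff_eq hq hp).mp (hq.dvd_of_dvd_pow hqp)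
    exact AddSubgroup.mem_iSup_of_mem (⟨q, hP q hq u hu hqu⟩ : P) ⟨n, hx⟩
  | coprime a b ha hb hab iha ihb =>
    intro x _ hx
    obtain ⟨s, t, hst⟩ := Nat.isCoprime_iff_coprime.mpr hab
    have hx' : x = s • (a • x) + t • (b • x) := by
      rw [← natCast_zsmul, ← natCast_zsmul, smul_smul, smul_smul, ← add_smul, hst, one_smul]
    rw [hx']
    refine add_mem (zsmul_mem (ihb _ (by omega) ?_) s) (zsmul_mem (iha _ (by omega) ?_) t)
    · rw [smul_smul, mul_comm, hx]
    · rw [smul_smul, hx]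

theorem IsTorsionWithCyclicSocles.isCocyclic_primarySubgroup (hG : IsTorsionWithCyclicSocles G)
    {p : ℕ} (hp : p.Prime) {u : G} (hu : u ≠ 0) (hpu : p • u = 0) :
    IsCocyclic (primarySubgroup G p) := by
  refine ⟨⟨u, 1, by rwa [pow_one]⟩, fun h ↦ hu (congrArg Subtype.val h), fun H hH ↦ ?_⟩
  obtain ⟨h, hh, h0⟩ := H.bot_or_exists_ne_zero.resolve_left hH
  obtain ⟨n, hn⟩ := h.2
  obtain ⟨q, hq, hqp, w, hw, hw0, hqw⟩ := exists_prime_zmultiples h0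
    (pow_ne_zero n hp.ne_zero) (Subtype.ext hn)
  obtain rfl := (Nat.prime_dvd_prime_iff_eq hq hp).mp (hq.dvd_of_dvd_pow hqp)
  obtain ⟨k, hk⟩ := AddSubgroup.mem_zmultiples_iff.mp (hG.2 q hq (w : G) u
    (fun e ↦ hw0 (Subtype.ext e)) (congrArg Subtype.val hqw) hpu)
  have hwH : w ∈ H := AddSubgroup.zmultiples_le_of_mem hh hw
  have hkw := zsmul_mem hwH k
  convert hkw using 1
  exact Subtype.ext hk.symm

theorem IsTorsionWithCyclicSocles.isDirectSum (hG : IsTorsionWithCyclicSocles G) :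
    IsDirectSumOfCocyclicsAtMostOnePerPrime G := by
  classical
  -- Primes with trivial socle are dropped, since the zero group is not cocyclic.
  let P : Set ℕ := {p | p.Prime ∧ ∃ u : G, u ≠ 0 ∧ p • u = 0}
  have hindep : iSupIndep fun p : P ↦ primarySubgroup G p :=
    iSupIndep_primarySubgroup fun p hp ↦ hp.1
  have htop : (⨆ p : P, primarySubgroup G p) = ⊤ := by
    refine eq_top_iff.mpr fun x _ ↦ mem_iSup_primarySubgroup (P := P)
      (fun p hp u hu hpu ↦ ⟨hp, u, hu, hpu⟩) _ x (hG.1 x).addOrderOf_pos.ne'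
      (addOrderOf_nsmul_eq_zero x)
  refine ⟨P, inferInstance, fun p ↦ primarySubgroup G p, ⟨hindep.dfinsuppSumAddHom_injective, ?_⟩,
    fun p ↦ ?_, fun p hp i j hi hj ↦ ?_⟩
  · refine AddMonoidHom.range_eq_top.mp ?_
    rw [eq_top_iff, ← htop]
    refine iSup_le fun p x hx ↦ ⟨DirectSum.of (fun p : P ↦ primarySubgroup G p) p ⟨x, hx⟩, ?_⟩
    exact DirectSum.coeAddMonoidHom_of _ _ _
  · obtain ⟨u, hu, hpu⟩ := p.2.2
    exact hG.isCocyclic_primarySubgroup p.2.1 hu hpu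
  · have key : ∀ i : P, IsPrimaryGroup p (primarySubgroup G i) → p = i := by
      intro i hi
      obtain ⟨hip, u, hu, hiu⟩ := i.2
      obtain ⟨n, hn⟩ := hi ⟨u, 1, by rwa [pow_one]⟩
      by_contra hne
      exact hu (eq_zero_of_coprime_nsmul
        (Nat.Coprime.pow_left n ((Nat.coprime_primes hp hip).mpr hne))
        (congrArg Subtype.val hn) hiu)
    exact Subtype.ext ((key i hi).symm.trans (key j hj))

end Decomposition

theorem theorem3p13 (G : Type*) [AddCommGroup G] :
    ((∀ K : AddSubgroup G, IsStrictlyInvariant K) ↔ IsDirectSumOfCocyclicsAtMostOnePerPrime G) ∧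
    ((∀ K : AddSubgroup G, IsStrictlyInvariant K) ↔
      ∀ K : AddSubgroup G, IsStronglyInvariant K) := by
  have hstrict : (∀ K : AddSubgroup G, IsStronglyInvariant K) →
      ∀ K : AddSubgroup G, IsStrictlyInvariant K := fun h K f _ ↦ h K f
  exact ⟨⟨fun h ↦ (IsTorsionWithCyclicSocles.of_isStrictlyInvariant h).isDirectSum,
      fun h ↦ hstrict h.isTorsionWithCyclicSocles.isStronglyInvariant⟩,
    ⟨fun h ↦ (IsTorsionWithCyclicSocles.of_isStrictlyInvariant h).isStronglyInvariant, hstrict⟩⟩
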